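/- A Motzkin path of width $n$ is a sequence of $n$ moves $U$ (up-right), $H$ (horizontal-right), $D$ (down-right) on the lattice that starts at $(0,0)$, never goes below the axis $y=0$ and ends on it; its area is the area of the region between the axis and the path. Its weight is $\omega(\mathit{mz})=\prod_{i=1}^n\omega_i$, where $h_i$ is the maximum height of the path during move $i$, $\omega_i=h_i$ if move $i$ is $U$ or $D$, and $\omega_i=2h_i+1$ if it is $H$. Let $MZ(n,A)$ be the set of Motzkin paths of width $n$ and area $A$. Let the tables $M$ and $D$ on triples of natural numbers be given by $M(0,0,0)=D(0,0,0)=1$, $M(0,A,l)=D(0,A,l)=0$ for $(A,l)\ne(0,0)$, and, for $n\ge 1$, $$M(n,A,l)=\sum_{l'=l}^{\lfloor n/2\rfloor}M(n-1,A-l,l')+[l\ge 1]\sum_{l'=l-1}^{\lfloor n/2\rfloor}M(n-2,A-(2l-1),l'),$$ $$D(n,A,l)=(2l+1)\sum_{l'=l}^{\lfloor n/2\rfloor}D(n-1,A-l,l')+[l\ge 1]\,l^2\sum_{l'=l-1}^{\lfloor n/2\rfloor}D(n-2,A-(2l-1),l'),$$ where $[l\ge1]$ is $1$ if $l\ge 1$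 and $0$ otherwise, and entries with a negative width or area are $0$. The model of computation is a random access machine with unit-cost instructions on natural numbers: constants, addition, truncated subtraction, multiplication, indirect load and store, (conditional) jumps, and drawing a uniformly random element of $\{0,\dots,r-1\}$ for a number $r$ held in a register. Theorem. There are a program $P$ of this machine and a constant $C$ such that the following holds for all $N,B$ and all $n\le N$, $A\le B$ with $MZ(n,A)\neq\emptyset$. Suppose that the memory contains the filled table of the dynamic program up to width $N$ and area $B$, that is, the values $M(m,a,l)$ and their prefix sums $\sum_{l'\le l}M(m,a,l')$ for all $m\le N$, $a\le B$, $l\le N$, and that the registers contain $n,A,N,B$. Then every run of $P$ halts after at most $C(n+1)$ steps, so in $\mathcal O(n)$ time, and outputs every path of $MZ(n,A)$ with probability exactly $1/|MZ(n,A)|$. Likewise, there are a program and a constant such that, with the table $D$ in place of $M$, every run halts after at most $C(n+1)$ steps and every $\mathit{mz}\in MZ(n,A)$ is output with probability exactly $\omega(\mathit{mz})/\sum_{q\in MZ(n,A)}\omega(q)$. -/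

import Mathlib

open scoped ENNReal

namespace MotzkinSampling

/-! ### Motzkin paths, their area and their weight -/

/-- The three moves: Up-right, Horizontal-right, Down-right. -/
inductive Move where
  | U
  | H
  | D
deriving DecidableEq

instance : Fintype Move := ⟨{.U, .H, .D}, fun x => by cases x <;> decide⟩

/-- Vertical displacement of a move. -/
def Move.dy : Move → ℤ
  | .U => 1
  | .H => 0
  | .D => -1

/-- The `y`-coordinate of the path `p` (started at the origin) after its first `i` moves. -/
def height (p : List Move) (i : ℕ) : ℤ := ((p.take i).map Move.dy).sum

/-- `p` never goes below the axis `y = 0` and ends on it. -/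
def IsMotzkin (p : List Move) : Prop :=
  (∀ i ≤ p.length, 0 ≤ height p i) ∧ height p p.length = 0

/-- Area of the region between the axis and the path: over move number `i` this region is a
trapezoid of width one with parallel sides `height p i` and `height p (i + 1)`. -/
def area (p : List Move) : ℚ :=
  ∑ i ∈ Finset.range p.length, ((height p i : ℚ) + (height p (i + 1) : ℚ)) / 2

/-- The factor of a move that is performed at maximum height `h`. -/
def Move.factor : Move → ℕ → ℕ
  | .U, h => h
  | .H, h => 2 * h + 1
  | .D, h => h

/-- The weight `ω` of a path: the product over its moves of `h` (for `U` and `D`) or of `2 h + 1`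
(for `H`), where `h` is the maximum height of the path during that move. -/
def weight (p : List Move) : ℕ :=
  ∏ i : Fin p.length, (p.get i).factor (max (height p i) (height p (i + 1))).toNat

/-- `MZ(n, A)`: the finite set of Motzkin paths of width `n` and area `A`. -/
noncomputable def motzkinPaths (n A : ℕ) : Finset (List Move) :=
  ((List.finite_length_eq Move n).subset
    (fun _ hp => hp.1 :
      {p : List Move | p.length = n ∧ IsMotzkin p ∧ area p = (A : ℚ)} ⊆
        {p : List Move | p.length = n})).toFinset

theorem mem_motzkinPaths {n A : ℕ} {p : List Move} :
    p ∈ motzkinPaths n A ↔ p.length = n ∧ IsMotzkin p ∧ area p = (A : ℚ) := by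
  simp [motzkinPaths]

/-! ### The dynamic program

The entry `(n, a, l)` belongs to the paths of width `n`, area `a` and last fall (maximal suffix of
`D` moves) of length `l`. An entry is computed from those before the insertion of a flat at height
`l` (which adds area `l`) or of a peak with top at height `l` (which adds area `2 l - 1`, `l ≥ 1`);
`flatW l` and `peakW l` are the factors contributed by the insertion. Entries with a negative width
or area are zero. -/
def dpTable (flatW peakW : ℕ → ℕ) : ℕ → ℕ → ℕ → ℕ
  | 0, a, l => if a = 0 ∧ l = 0 then 1 else 0
  | 1, a, l =>
      if l ≤ a then
        flatW l * ∑ l' ∈ Finset.Icc l (1 / 2), dpTable flatW peakW 0 (a - l) l'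
      else 0
  | n + 2, a, l =>
      (if l ≤ a then
        flatW l * ∑ l' ∈ Finset.Icc l ((n + 2) / 2), dpTable flatW peakW (n + 1) (a - l) l'
      else 0) +
      (if 1 ≤ l ∧ 2 * l - 1 ≤ a then
        peakW l * ∑ l' ∈ Finset.Icc (l - 1) ((n + 2) / 2),
          dpTable flatW peakW n (a - (2 * l - 1)) l'
      else 0)

/-- The table `M(n, A, l)` for unweighted paths. -/
def tableM : ℕ → ℕ → ℕ → ℕ := dpTable (fun _ => 1) (fun _ => 1)

/-- The table `D(n, d, l)` for paths weighted by `ω`. -/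
def tableD : ℕ → ℕ → ℕ → ℕ := dpTable (fun l => 2 * l + 1) (fun l => l ^ 2)

/-! ### A randomized random access machine with unit-cost instructions -/

/-- Instructions; `d`, `a`, `b` are names of registers and `t` is a line number of the program. -/
inductive Instr where
  /-- `reg d := k` for a constant `k` -/
  | const (d k : ℕ)
  /-- `reg d := reg a + reg b` -/
  | add (d a b : ℕ)
  /-- `reg d := max (reg a - reg b) 0` -/
  | sub (d a b : ℕ)
  /-- `reg d := reg a * reg b` -/
  | mul (d a b : ℕ)
  /-- `reg d := mem (reg a)` -/
  | load (d a : ℕ)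
  /-- `mem (reg a) := reg b` -/
  | store (a b : ℕ)
  /-- `reg d :=` a fresh uniformly random element of `{0, …, reg a - 1}` (`0` if `reg a = 0`) -/
  | rand (d a : ℕ)
  /-- go to line `t` if `reg a < reg b` -/
  | jlt (a b t : ℕ)
  /-- go to line `t` -/
  | jmp (t : ℕ)

/-- A program is a finite list of instructions. -/
abbrev Program := List Instr

/-- A configuration: program counter, registers and memory. -/
@[ext]
structure Config where
  pc : ℕ
  reg : ℕ → ℕ
  mem : ℕ → ℕ

/-- Assign `v` to register `d` and go to the next line. -/
def Config.setReg (c : Config) (d v : ℕ) : Config :=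
  { c with pc := c.pc + 1, reg := Function.update c.reg d v }

/-- The uniform distribution on `{0, …, m - 1}` (the point mass at `0` if `m = 0`). -/
noncomputable def uniformBelow (m : ℕ) : PMF ℕ :=
  if h : (Finset.range m).Nonempty then PMF.uniformOfFinset (Finset.range m) h else PMF.pure 0

/-- Execution of one instruction. -/
noncomputable def exec (c : Config) : Instr → PMF Config
  | .const d k => PMF.pure (c.setReg d k)
  | .add d a b => PMF.pure (c.setReg d (c.reg a + c.reg b))
  | .sub d a b => PMF.pure (c.setReg d (c.reg a - c.reg b))
  | .mul d a b => PMF.pure (c.setReg d (c.reg a * c.reg b))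
  | .load d a => PMF.pure (c.setReg d (c.mem (c.reg a)))
  | .store a b =>
      PMF.pure { c with pc := c.pc + 1, mem := Function.update c.mem (c.reg a) (c.reg b) }
  | .rand d a => (uniformBelow (c.reg a)).map (fun v => c.setReg d v)
  | .jlt a b t => PMF.pure { c with pc := if c.reg a < c.reg b then t else c.pc + 1 }
  | .jmp t => PMF.pure { c with pc := t }

/-- The machine has halted when the program counter has left the program. -/
def Halted (P : Program) (c : Config) : Prop := P.length ≤ c.pc

/-- One step of the machine; a halted configuration no longer changes. -/
noncomputable def step (P : Program) (c : Config) : PMF Config :=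
  match P[c.pc]? with
  | none => PMF.pure c
  | some i => exec c i

/-- The law of the configuration after `k` steps from `c`. -/
noncomputable def run (P : Program) : ℕ → Config → PMF Config
  | 0, c => PMF.pure c
  | k + 1, c => (step P c).bind (run P k)

/-! ### The filled table in memory, and linear-time samplers -/

/-- Number of entries `(m, a, l)` with `m ≤ N`, `a ≤ B`, `l ≤ N`. -/
def tableSize (N B : ℕ) : ℕ := (N + 1) * (B + 1) * (N + 1)

/-- Row-major position of the entry `(m, a, l)`. -/
def entryIndex (N B m a l : ℕ) : ℕ := (m * (B + 1) + a) * (N + 1) + l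

/-- The memory holds the table `T` up to width `N` and area `B`, in row-major order from cell `0`
on, followed by the table of its partial sums over the last-fall length, in the same order. -/
def TableFilled (T : ℕ → ℕ → ℕ → ℕ) (N B : ℕ) (mem : ℕ → ℕ) : Prop :=
  ∀ m ≤ N, ∀ a ≤ B, ∀ l ≤ N,
    mem (entryIndex N B m a l) = T m a l ∧
    mem (tableSize N B + entryIndex N B m a l) = ∑ l' ∈ Finset.range (l + 1), T m a l'

/-- The number by which a move is represented in memory. -/
def Move.code : Move → ℕ
  | .U => 0
  | .H => 1
  | .D => 2

/-- The contents of the `n` memory cells that follow the two tables. -/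
def outputCells (N B n : ℕ) (c : Config) : List ℕ :=
  (List.range n).map (fun i => c.mem (2 * tableSize N B + i))

/-- The program `P` samples from the Motzkin paths of given width and area with probability
proportional to `w`, in linear time, from the filled table `T`. There is one constant `C` such that
the following holds for all table dimensions `N`, `B`, for every width `n ≤ N` and area `A ≤ B`
attained by a Motzkin path, and for every configuration at line `0` with `n, A, N, B` in the
registers `0, 1, 2, 3` and with the filled table in memory (all other registers and cells being
arbitrary): every run has halted after at most `C * (n + 1)` steps, and the probability that its
output is a given path `p` of width `n` and area `A` is `w p` divided by the total weight of all
these paths. -/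
def IsLinearTimeSampler (T : ℕ → ℕ → ℕ → ℕ) (w : List Move → ℕ) (P : Program) : Prop :=
  ∃ C : ℕ, ∀ N B n A : ℕ, n ≤ N → A ≤ B → (motzkinPaths n A).Nonempty →
    ∀ c : Config, c.pc = 0 → c.reg 0 = n → c.reg 1 = A → c.reg 2 = N → c.reg 3 = B →
      TableFilled T N B c.mem →
        (∀ c' ∈ (run P (C * (n + 1)) c).support, Halted P c') ∧
        ∀ p ∈ motzkinPaths n A,
          ((run P (C * (n + 1)) c).map (outputCells N B n)) (p.map Move.code) =
            (w p : ℝ≥0∞) / ((∑ q ∈ motzkinPaths n A, w q : ℕ) : ℝ≥0∞)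

end MotzkinSampling

namespace MotzkinSampling

/-! ### Appending a move to a path -/

/-! The path is drawn backwards, one move at a time. A state `(k, a, l)` records that a prefix of
length `k` ending at height `l` is still to be drawn, and that appending a fall of length `l` to it
gives a Motzkin path of width `k + l` and area `a`. The completed paths are exactly those of this
width and area whose last fall has length at least `l`.

Removing the last move of the prefix leads to `(k - 1, a, l + 1)` for `D`, to `(k - 1, a - l, l)`
for `H` (a flat is deleted) and to `(k - 1, a - (2 * l - 1), l - 1)` for `U` (a peak is deleted).
The weights change by 1, `flatW l` and `peakW l` respectively. This gives a recursion for the total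
weight `prefixTotal` of a state, and the dynamic program implies that this total is the tail from
`l` on of row `(k + l, a)` of the table (`sum_Icc_dpTable`). A tail is the entry at `l` plus a
difference of two stored partial sums, hence available in constant time (`TableFilled.tail`).

Choosing each last move with probability proportional to the weight of the prefixes having it makes
the probabilities telescope to weight over total (`WeightSystem.backwardChain_apply`). One random
number below the state's total decides: it is compared with the share of `D`, then with the shares
of `D` and `H` together. The share of `U` is the remainder, so the program needs no value of
`peakW`. `map_observe_run` identifies the law of the program with this chain and bounds its time. -/

theorem height_append_of_le (s t : List Move) {i : ℕ} (h : i ≤ s.length) :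
    height (s ++ t) i = height s i := by
  simp [height, List.take_append_of_le_length h]

theorem height_concat_length (s : List Move) (m : Move) :
    height (s ++ [m]) (s.length + 1) = height s s.length + m.dy := by
  simp [height, List.take_of_length_le]

theorem area_concat (s : List Move) (m : Move) :
    area (s ++ [m]) = area s + ((height s s.length : ℚ) + (height s s.length + m.dy : ℤ)) / 2 := by
  unfold area
  rw [List.length_append, List.length_singleton, Finset.sum_range_succ, height_concat_length,
    height_append_of_le s [m] le_rfl]
  congr 1
  refine Finset.sum_congr rfl fun i hi => ?_
  rw [Finset.mem_range] at hi
  rw [height_append_of_le s [m] hi.le, height_append_of_le s [m] hi]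

/-- The product over the moves of `p` of the factors `F`, which depend on the move and on its
maximum height. -/
def pathWeight (F : Move → ℕ → ℕ) (p : List Move) : ℕ :=
  ∏ i : Fin p.length, F (p.get i) (max (height p i) (height p (i + 1))).toNat

/-- A product over `Finset.range` lets the last factor be split off. The default move `.U` is never
read. -/
theorem pathWeight_eq_prod_range (F : Move → ℕ → ℕ) (p : List Move) :
    pathWeight F p = ∏ i ∈ Finset.range p.length,
      F (p.getD i .U) (max (height p i) (height p (i + 1))).toNat := by
  rw [Finset.prod_range, pathWeight]
  refine Finset.prod_congr rfl fun i _ => ?_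
  simp

theorem pathWeight_concat (F : Move → ℕ → ℕ) (s : List Move) (m : Move) :
    pathWeight F (s ++ [m]) = pathWeight F s *
      F m (max (height s s.length) (height s s.length + m.dy)).toNat := by
  rw [pathWeight_eq_prod_range, pathWeight_eq_prod_range, List.length_append,
    List.length_singleton, Finset.prod_range_succ, height_concat_length,
    height_append_of_le s [m] le_rfl]
  congr 1
  · refine Finset.prod_congr rfl fun i hi => ?_
    rw [Finset.mem_range] at hi
    rw [height_append_of_le s [m] hi.le, height_append_of_le s [m] hi,
      List.getD_append _ _ _ _ hi]
  · simp

/-- The path `p` never goes below the axis. -/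
def StaysNonneg (p : List Move) : Prop := ∀ i ≤ p.length, 0 ≤ height p i

theorem staysNonneg_concat (s : List Move) (m : Move) :
    StaysNonneg (s ++ [m]) ↔ StaysNonneg s ∧ 0 ≤ height s s.length + m.dy := by
  constructor
  · intro h
    refine ⟨fun i hi => ?_, ?_⟩
    · rw [← height_append_of_le s [m] hi]
      exact h i (by simp; omega)
    · rw [← height_concat_length]
      exact h _ (by simp)
  · rintro ⟨h, h'⟩ i hi
    rcases Nat.lt_or_ge s.length i with hlt | hle
    · obtain rfl : i = s.length + 1 := by simp at hi; omega
      rwa [height_concat_length]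
    · rw [height_append_of_le s [m] hle]
      exact h i hle

theorem area_nonneg {p : List Move} (hp : StaysNonneg p) : 0 ≤ area p := by
  refine Finset.sum_nonneg fun i hi => ?_
  rw [Finset.mem_range] at hi
  have h : (0 : ℚ) ≤ height p i := by exact_mod_cast hp i hi.le
  have h' : (0 : ℚ) ≤ height p (i + 1) := by exact_mod_cast hp (i + 1) hi
  positivity

/-! ### Prefixes of Motzkin paths, completed by a final fall -/

/-- The path `s` never goes below the axis, ends at height `l`, and becomes a Motzkin path of
area `a` when a fall of length `l` is appended. -/
def CompletesTo (s : List Move) (a l : ℕ) : Prop :=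
  StaysNonneg s ∧ height s s.length = l ∧ area s + (l : ℚ) ^ 2 / 2 = a

theorem completesTo_nil (a l : ℕ) : CompletesTo [] a l ↔ a = 0 ∧ l = 0 := by
  constructor
  · rintro ⟨-, h, h'⟩
    have hl : l = 0 := by simpa [height, eq_comm] using h
    subst hl
    simpa [area, eq_comm] using h'
  · rintro ⟨rfl, rfl⟩
    simp [CompletesTo, StaysNonneg, height, area]

/-- Both sides describe the same completed path: the last `D` is merely counted as part of the fall.
-/
theorem completesTo_concat_D (s : List Move) (a l : ℕ) :
    CompletesTo (s ++ [.D]) a l ↔ CompletesTo s a (l + 1) := by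
  simp only [CompletesTo, staysNonneg_concat, area_concat, List.length_append,
    List.length_singleton, height_concat_length, Move.dy]
  constructor
  · rintro ⟨⟨h1, -⟩, h2, h3⟩
    have h : height s s.length = l + 1 := by omega
    refine ⟨h1, by push_cast; exact h, ?_⟩
    rw [h] at h3
    push_cast at h3 ⊢
    linarith
  · rintro ⟨h1, h, h3⟩
    rw [h]
    push_cast at h3 ⊢
    refine ⟨⟨h1, by linarith⟩, by ring, by linarith⟩

/-- Deleting the flat at height `l` removes area `l`. What remains has nonnegative area, whence `l ≤
a`. -/
theorem completesTo_concat_H (s : List Move) (a l : ℕ) :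
    CompletesTo (s ++ [.H]) a l ↔ l ≤ a ∧ CompletesTo s (a - l) l := by
  simp only [CompletesTo, staysNonneg_concat, area_concat, List.length_append,
    List.length_singleton, height_concat_length, Move.dy, add_zero]
  constructor
  · rintro ⟨⟨h1, -⟩, h, h3⟩
    rw [h] at h3
    have h0 := area_nonneg h1
    have hla : l ≤ a := by
      have : (l : ℚ) ≤ a := by
        push_cast at h3
        nlinarith [sq_nonneg (l : ℚ)]
      exact_mod_cast this
    refine ⟨hla, h1, h, ?_⟩
    push_cast [hla] at h3 ⊢
    linarith
  · rintro ⟨hla, h1, h, h3⟩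
    rw [h]
    push_cast [hla] at h3 ⊢
    exact ⟨⟨h1, by positivity⟩, rfl, by linarith⟩

/-- The last `U` and the first move of the fall form a peak. Each covers area `(2 * l - 1) / 2`. -/
theorem completesTo_concat_U (s : List Move) (a l : ℕ) :
    CompletesTo (s ++ [.U]) a l ↔
      (1 ≤ l ∧ 2 * l - 1 ≤ a) ∧ CompletesTo s (a - (2 * l - 1)) (l - 1) := by
  simp only [CompletesTo, staysNonneg_concat, area_concat, List.length_append,
    List.length_singleton, height_concat_length, Move.dy]
  constructor
  · rintro ⟨⟨h1, -⟩, h, h3⟩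
    have hend := h1 s.length le_rfl
    obtain ⟨j, rfl⟩ : ∃ j, l = j + 1 := ⟨l - 1, by omega⟩
    have hj : height s s.length = j := by push_cast at h; linarith
    rw [hj] at h3
    have h0 := area_nonneg h1
    have hla : 2 * j + 1 ≤ a := by
      have : (2 * j + 1 : ℚ) ≤ a := by
        push_cast at h3
        nlinarith [sq_nonneg (j : ℚ)]
      exact_mod_cast this
    have e : 2 * (j + 1) - 1 = 2 * j + 1 := by omega
    rw [e]
    refine ⟨⟨by omega, hla⟩, h1, by simpa using hj, ?_⟩
    push_cast [hla] at h3 ⊢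
    linarith
  · rintro ⟨⟨hl, hla⟩, h1, h, h3⟩
    obtain ⟨j, rfl⟩ : ∃ j, l = j + 1 := ⟨l - 1, by omega⟩
    have e : 2 * (j + 1) - 1 = 2 * j + 1 := by omega
    rw [e] at hla h3
    rw [h]
    simp only [Nat.add_sub_cancel] at h3 ⊢
    push_cast [hla] at h3 ⊢
    exact ⟨⟨h1, by positivity⟩, rfl, by linarith⟩

/-- Factors `F` of the moves that are compatible with the insertion factors `flatW` and `peakW` of
the dynamic program; `fallW l` is the weight of a fall from height `l` to the axis. -/
structure WeightSystem (flatW peakW : ℕ → ℕ) (F : Move → ℕ → ℕ) (fallW : ℕ → ℕ) : Prop where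
  fall_zero : fallW 0 = 1
  down : ∀ l, F .D (l + 1) * fallW l = fallW (l + 1)
  flat : ∀ l, F .H l = flatW l
  up : ∀ l, F .U (l + 1) * fallW (l + 1) = peakW (l + 1) * fallW l
  pos : ∀ m l, 0 < F m (l + 1)
  pos_flat : 0 < F .H 0

open Classical in
/-- The weight of the completion of the prefix `s` if it has area `a` and `s` ends at height `l`. -/
noncomputable def completionWeight (F : Move → ℕ → ℕ) (fallW : ℕ → ℕ) (s : List Move)
    (a l : ℕ) : ℕ :=
  if CompletesTo s a l then pathWeight F s * fallW l else 0

section WeightSystem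

variable {flatW peakW : ℕ → ℕ} {F : Move → ℕ → ℕ} {fallW : ℕ → ℕ}

/-- Above the axis `U` and `D` have maximum height at least 1, so a vanishing factor of these moves
at height 0 does no harm. Positivity makes the total nonzero as soon as one path exists. -/
theorem WeightSystem.pathWeight_pos (hF : WeightSystem flatW peakW F fallW) (s : List Move)
    (hs : StaysNonneg s) : 0 < pathWeight F s := by
  induction s using List.reverseRecOn with
  | nil => simp [pathWeight]
  | append_singleton s m ih =>
    obtain ⟨h1, h2⟩ := (staysNonneg_concat s m).1 hs
    rw [pathWeight_concat]
    refine Nat.mul_pos (ih h1) ?_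
    have h3 := h1 s.length le_rfl
    obtain ⟨j, hj⟩ := Int.eq_ofNat_of_zero_le h3
    rw [hj] at h2 ⊢
    cases m with
    | U =>
      have : (max (j : ℤ) (j + Move.U.dy)).toNat = j + 1 := by simp only [Move.dy]; omega
      rw [this]; exact hF.pos _ _
    | H =>
      have : (max (j : ℤ) (j + Move.H.dy)).toNat = j := by simp only [Move.dy]; omega
      rw [this]
      cases j with
      | zero => exact hF.pos_flat
      | succ j => exact hF.pos _ _
    | D =>
      simp only [Move.dy] at h2
      have : (max (j : ℤ) (j + Move.D.dy)).toNat = (j - 1) + 1 := by simp only [Move.dy]; omega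
      rw [this]; exact hF.pos _ _

theorem WeightSystem.completionWeight_nil (hF : WeightSystem flatW peakW F fallW) (a l : ℕ) :
    completionWeight F fallW [] a l = if a = 0 ∧ l = 0 then 1 else 0 := by
  rw [completionWeight]
  by_cases h : a = 0 ∧ l = 0
  · rw [if_pos ((completesTo_nil a l).2 h), if_pos h, h.2, hF.fall_zero]
    simp [pathWeight]
  · rw [if_neg (mt (completesTo_nil a l).1 h), if_neg h]

theorem WeightSystem.completionWeight_concat_D (hF : WeightSystem flatW peakW F fallW)
    (s : List Move) (a l : ℕ) :
    completionWeight F fallW (s ++ [.D]) a l = completionWeight F fallW s a (l + 1) := by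
  rw [completionWeight, completionWeight]
  by_cases h : CompletesTo s a (l + 1)
  · have : (max ((l + 1 : ℕ) : ℤ) ((l + 1 : ℕ) + Move.D.dy)).toNat = l + 1 := by
      simp only [Move.dy]; omega
    rw [if_pos ((completesTo_concat_D s a l).2 h), if_pos h, pathWeight_concat, h.2.1, ← hF.down,
      mul_assoc, this]
  · rw [if_neg (mt (completesTo_concat_D s a l).1 h), if_neg h]

theorem WeightSystem.completionWeight_concat_H (hF : WeightSystem flatW peakW F fallW)
    (s : List Move) (a l : ℕ) :
    completionWeight F fallW (s ++ [.H]) a l =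
      if l ≤ a then flatW l * completionWeight F fallW s (a - l) l else 0 := by
  rw [completionWeight, completionWeight]
  by_cases h : l ≤ a ∧ CompletesTo s (a - l) l
  · have : (max (l : ℤ) (l + Move.H.dy)).toNat = l := by
      simp only [Move.dy]; omega
    rw [if_pos ((completesTo_concat_H s a l).2 h), if_pos h.1, if_pos h.2, pathWeight_concat,
      h.2.2.1, ← hF.flat, this]
    ring
  · rw [if_neg (mt (completesTo_concat_H s a l).1 h)]
    split_ifs with h1 h2
    · exact absurd ⟨h1, h2⟩ h
    · simp
    · rfl

theorem WeightSystem.completionWeight_concat_U (hF : WeightSystem flatW peakW F fallW)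
    (s : List Move) (a l : ℕ) :
    completionWeight F fallW (s ++ [.U]) a l =
      if 1 ≤ l ∧ 2 * l - 1 ≤ a then
        peakW l * completionWeight F fallW s (a - (2 * l - 1)) (l - 1) else 0 := by
  rw [completionWeight, completionWeight]
  by_cases h : (1 ≤ l ∧ 2 * l - 1 ≤ a) ∧ CompletesTo s (a - (2 * l - 1)) (l - 1)
  · rw [if_pos ((completesTo_concat_U s a l).2 h), if_pos h.1, if_pos h.2, pathWeight_concat,
      h.2.2.1]
    obtain ⟨j, rfl⟩ : ∃ j, l = j + 1 := ⟨l - 1, by omega⟩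
    have : (max ((j + 1 - 1 : ℕ) : ℤ) ((j + 1 - 1 : ℕ) + Move.U.dy)).toNat = j + 1 := by
      simp only [Move.dy]; omega
    rw [this, mul_assoc, hF.up]
    simp only [Nat.add_sub_cancel]
    ring
  · rw [if_neg (mt (completesTo_concat_U s a l).1 h)]
    split_ifs with h1 h2
    · exact absurd ⟨h1, h2⟩ h
    · simp
    · rfl

end WeightSystem

/-- The lists of moves of length `k`. -/
def words : ℕ → Finset (List Move)
  | 0 => {[]}
  | k + 1 => (words k ×ˢ Finset.univ).image fun x => x.1 ++ [x.2]

theorem mem_words {k : ℕ} {s : List Move} : s ∈ words k ↔ s.length = k := by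
  induction k generalizing s with
  | zero => simp [words]
  | succ k ih =>
    simp only [words, Finset.mem_image, Finset.mem_product, ih, Finset.mem_univ, and_true,
      Prod.exists]
    constructor
    · rintro ⟨t, m, rfl, rfl⟩; simp
    · intro h
      rcases s.eq_nil_or_concat' with rfl | ⟨t, m, rfl⟩
      · simp at h
      · exact ⟨t, m, by simpa using h, rfl⟩

theorem sum_words_succ (f : List Move → ℕ) (k : ℕ) :
    ∑ s ∈ words (k + 1), f s =
      ∑ s ∈ words k, f (s ++ [.D]) + ∑ s ∈ words k, f (s ++ [.H]) +
        ∑ s ∈ words k, f (s ++ [.U]) := by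
  rw [words, Finset.sum_image, Finset.sum_product, ← Finset.sum_add_distrib,
    ← Finset.sum_add_distrib]
  · refine Finset.sum_congr rfl fun s _ => ?_
    have : (Finset.univ : Finset Move) = {.U, .H, .D} := rfl
    rw [this, Finset.sum_insert (by decide), Finset.sum_insert (by decide), Finset.sum_singleton]
    ring
  · rintro ⟨s, m⟩ - ⟨s', m'⟩ - h
    simpa using h

/-! ### The number of prefixes of given length, completed area and final height -/

/-- The total weight of the completed prefixes of length `k`, completed area `a` and final height
`l`, computed by removing the last move of the prefix. -/
def prefixTotal (flatW peakW : ℕ → ℕ) : ℕ → ℕ → ℕ → ℕ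
  | 0, a, l => if a = 0 ∧ l = 0 then 1 else 0
  | k + 1, a, l =>
      prefixTotal flatW peakW k a (l + 1) +
      (if l ≤ a then flatW l * prefixTotal flatW peakW k (a - l) l else 0) +
      (if 1 ≤ l ∧ 2 * l - 1 ≤ a then
        peakW l * prefixTotal flatW peakW k (a - (2 * l - 1)) (l - 1) else 0)

section Totals

variable {flatW peakW : ℕ → ℕ} {F : Move → ℕ → ℕ} {fallW : ℕ → ℕ}

theorem WeightSystem.sum_completionWeight (hF : WeightSystem flatW peakW F fallW) (k a l : ℕ) :
    ∑ s ∈ words k, completionWeight F fallW s a l = prefixTotal flatW peakW k a l := by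
  induction k generalizing a l with
  | zero => simp [words, hF.completionWeight_nil, prefixTotal]
  | succ k ih =>
    rw [sum_words_succ, prefixTotal]
    simp only [hF.completionWeight_concat_D, hF.completionWeight_concat_H,
      hF.completionWeight_concat_U]
    congr 1
    · congr 1
      · exact ih _ _
      · split_ifs
        · rw [← Finset.mul_sum, ih]
        · simp
    · split_ifs
      · rw [← Finset.mul_sum, ih]
      · simp

theorem WeightSystem.completionWeight_le (hF : WeightSystem flatW peakW F fallW)
    (s : List Move) (a l : ℕ) :
    completionWeight F fallW s a l ≤ prefixTotal flatW peakW s.length a l := by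
  rw [← hF.sum_completionWeight]
  exact Finset.single_le_sum (f := fun s => completionWeight F fallW s a l)
    (fun _ _ => Nat.zero_le _) (mem_words.2 rfl)

theorem completesTo_zero_iff (p : List Move) (A : ℕ) :
    CompletesTo p A 0 ↔ IsMotzkin p ∧ area p = A := by
  simp [CompletesTo, IsMotzkin, StaysNonneg, and_assoc]

theorem WeightSystem.completionWeight_of_mem (hF : WeightSystem flatW peakW F fallW)
    {n A : ℕ} {p : List Move} (hp : p ∈ motzkinPaths n A) :
    completionWeight F fallW p A 0 = pathWeight F p := by
  rw [completionWeight, if_pos ((completesTo_zero_iff p A).2 (mem_motzkinPaths.1 hp).2),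
    hF.fall_zero, mul_one]

theorem WeightSystem.sum_pathWeight (hF : WeightSystem flatW peakW F fallW) (n A : ℕ) :
    ∑ q ∈ motzkinPaths n A, pathWeight F q = prefixTotal flatW peakW n A 0 := by
  rw [← hF.sum_completionWeight]
  have hsub : motzkinPaths n A ⊆ words n := fun p hp => mem_words.2 (mem_motzkinPaths.1 hp).1
  rw [← Finset.sum_subset hsub]
  · exact Finset.sum_congr rfl fun p hp => (hF.completionWeight_of_mem hp).symm
  · intro p hp hp'
    rw [completionWeight, if_neg]
    rw [completesTo_zero_iff]
    exact fun h => hp' (mem_motzkinPaths.2 ⟨mem_words.1 hp, h⟩)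

theorem WeightSystem.prefixTotal_pos (hF : WeightSystem flatW peakW F fallW) {n A : ℕ}
    (h : (motzkinPaths n A).Nonempty) : 0 < prefixTotal flatW peakW n A 0 := by
  obtain ⟨p, hp⟩ := h
  have h1 := hF.completionWeight_le p A 0
  rw [hF.completionWeight_of_mem hp, (mem_motzkinPaths.1 hp).1] at h1
  exact (hF.pathWeight_pos p (mem_motzkinPaths.1 hp).2.1.1).trans_le h1

end Totals

/-! ### Prefix totals are tails of the rows of the dynamic program -/

section Table

variable (flatW peakW : ℕ → ℕ)

/-- A fall of length `l` requires at least `l` rises. In the recursion, every `l'` summed over again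
exceeds half of the smaller width. -/
theorem dpTable_eq_zero (n a l : ℕ) (h : n < 2 * l) : dpTable flatW peakW n a l = 0 := by
  induction n using Nat.strong_induction_on generalizing a l with
  | _ n ih =>
    match n, ih, h with
    | 0, _, h => rw [dpTable, if_neg (by omega)]
    | 1, _, h =>
      rw [dpTable, Finset.Icc_eq_empty (by omega)]
      simp
    | n + 2, ih, h =>
      rw [dpTable]
      have h1 : ∑ l' ∈ Finset.Icc l ((n + 2) / 2), dpTable flatW peakW (n + 1) (a - l) l' = 0 :=
        Finset.sum_eq_zero fun l' hl' => by
          rw [Finset.mem_Icc] at hl'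
          exact ih _ (by omega) _ _ (by omega)
      have h2 : ∑ l' ∈ Finset.Icc (l - 1) ((n + 2) / 2),
          dpTable flatW peakW n (a - (2 * l - 1)) l' = 0 :=
        Finset.sum_eq_zero fun l' hl' => by
          rw [Finset.mem_Icc] at hl'
          exact ih _ (by omega) _ _ (by omega)
      rw [h1, h2]
      simp

theorem sum_Icc_dpTable_eq (n a l u v : ℕ) (hu : n / 2 ≤ u) (hv : n / 2 ≤ v) :
    ∑ l' ∈ Finset.Icc l u, dpTable flatW peakW n a l' =
      ∑ l' ∈ Finset.Icc l v, dpTable flatW peakW n a l' := by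
  have key : ∀ w, n / 2 ≤ w → ∑ l' ∈ Finset.Icc l w, dpTable flatW peakW n a l' =
      ∑ l' ∈ Finset.Icc l (n / 2), dpTable flatW peakW n a l' := fun w hw =>
    (Finset.sum_subset (Finset.Icc_subset_Icc_right hw) fun x hx hx' => by
      rw [Finset.mem_Icc] at hx hx'
      exact dpTable_eq_zero _ _ _ _ _ (by omega)).symm
  rw [key u hu, key v hv]

/-- The tail is split into its first entry and the rest. The rest belongs to a prefix ending in `D`,
in the same row since `k + (l + 1) = k + 1 + l`. The recursion of the table writes the first entry
as a flat tail plus a peak tail, and these are the `H` and `U` terms. -/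
theorem sum_Icc_dpTable (k a l u : ℕ) (hu : k + l ≤ u) :
    ∑ l' ∈ Finset.Icc l u, dpTable flatW peakW (k + l) a l' = prefixTotal flatW peakW k a l := by
  induction k generalizing a l u with
  | zero =>
    rw [sum_Icc_dpTable_eq _ _ _ _ _ _ l (by omega) (by omega), Finset.Icc_self,
      Finset.sum_singleton, prefixTotal]
    rcases Nat.eq_zero_or_pos l with rfl | hl
    · rw [dpTable]
    · rw [dpTable_eq_zero _ _ _ _ _ (by omega), if_neg (by omega)]
  | succ k ih =>
    rw [← Finset.add_sum_Ioc_eq_sum_Icc (by omega), prefixTotal, add_comm]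
    have h1 : ∑ l' ∈ Finset.Ioc l u, dpTable flatW peakW (k + 1 + l) a l' =
        prefixTotal flatW peakW k a (l + 1) := by
      rw [← ih a (l + 1) u (by omega), show k + (l + 1) = k + 1 + l by omega]
      exact Finset.sum_congr (by ext; simp) fun _ _ => rfl
    have h2 : ∑ l' ∈ Finset.Icc l ((k + 1 + l) / 2), dpTable flatW peakW (k + l) (a - l) l' =
        prefixTotal flatW peakW k (a - l) l := by
      rw [← ih (a - l) l (k + l) le_rfl]
      exact sum_Icc_dpTable_eq _ _ _ _ _ _ _ (by omega) (by omega)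
    have h3 : 1 ≤ l → ∑ l' ∈ Finset.Icc (l - 1) ((k + 1 + l) / 2),
        dpTable flatW peakW (k + l - 1) (a - (2 * l - 1)) l' =
        prefixTotal flatW peakW k (a - (2 * l - 1)) (l - 1) := by
      intro hl
      rw [← ih (a - (2 * l - 1)) (l - 1) (k + (l - 1)) le_rfl,
        show k + (l - 1) = k + l - 1 by omega]
      exact sum_Icc_dpTable_eq _ _ _ _ _ _ _ (by omega) (by omega)
    rw [h1, add_assoc (prefixTotal _ _ _ _ _)]
    congr 1
    rw [← h2]
    clear h1 h2 ih
    -- Width 1 has its own clause in `dpTable`, without a peak term.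
    obtain hn | ⟨n, hn⟩ : k + l = 0 ∨ ∃ n, k + l = n + 1 := by
      rcases Nat.eq_zero_or_pos (k + l) with h | h
      · exact .inl h
      · exact .inr ⟨k + l - 1, by omega⟩
    · obtain ⟨rfl, rfl⟩ : k = 0 ∧ l = 0 := by omega
      simp [dpTable]
    · have e : k + 1 + l = n + 2 := by omega
      rw [e, hn] at h3 ⊢
      simp only [Nat.add_sub_cancel] at h3
      rw [dpTable]
      congr 1
      split_ifs with h
      · rw [h3 h.1]
      · rfl

end Table

/-! ### Facts about discrete distributions -/

/-- Program and chain thus need to agree only for draws below the total, which excludes branches of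
weight zero. -/
theorem uniformBelow_bind_congr {β : Type*} {m : ℕ} (hm : 0 < m) {f g : ℕ → PMF β}
    (h : ∀ r < m, f r = g r) : (uniformBelow m).bind f = (uniformBelow m).bind g := by
  ext b
  rw [PMF.bind_apply, PMF.bind_apply]
  refine tsum_congr fun r => ?_
  by_cases hr : r < m
  · rw [h r hr]
  · rw [uniformBelow, dif_pos (Finset.nonempty_range_iff.2 hm.ne'),
      PMF.uniformOfFinset_apply_of_notMem _ (by simpa using hr), zero_mul, zero_mul]

/-- A choice among three alternatives with probabilities proportional to `x`, `y` and `z`. -/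
theorem uniformBelow_bind_apply {β : Type*} {x y z : ℕ} (hm : 0 < x + y + z) (μ ν ρ : PMF β)
    (b : β) :
    ((uniformBelow (x + y + z)).bind fun r => if r < x then μ else if r < x + y then ν else ρ) b =
      (x * μ b + y * ν b + z * ρ b) / ((x + y + z : ℕ) : ℝ≥0∞) := by
  have hne : (Finset.range (x + y + z)).Nonempty := Finset.nonempty_range_iff.2 hm.ne'
  rw [PMF.bind_apply, uniformBelow, dif_pos hne,
    tsum_eq_sum (s := Finset.range (x + y + z))]
  · have h1 : ∀ r ∈ Finset.range (x + y + z),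
        PMF.uniformOfFinset (Finset.range (x + y + z)) hne r *
          (if r < x then μ else if r < x + y then ν else ρ) b =
        ((x + y + z : ℕ) : ℝ≥0∞)⁻¹ * (if r < x then μ b else if r < x + y then ν b else ρ b) := by
      intro r hr
      rw [PMF.uniformOfFinset_apply_of_mem _ hr, Finset.card_range]
      split_ifs <;> rfl
    rw [Finset.sum_congr rfl h1, ← Finset.mul_sum, Finset.sum_range_add, Finset.sum_range_add,
      div_eq_mul_inv, mul_comm]
    congr 1
    congr 1
    · congr 1
      · rw [Finset.sum_congr rfl (g := fun _ => μ b) fun r hr => if_pos (Finset.mem_range.1 hr)]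
        simp
      · rw [Finset.sum_congr rfl (g := fun _ => ν b)]
        · simp
        · intro r hr
          rw [Finset.mem_range] at hr
          rw [if_neg (by omega), if_pos (by omega)]
    · rw [Finset.sum_congr rfl (g := fun _ => ρ b)]
      · simp
      · intro r hr
        rw [Finset.mem_range] at hr
        rw [if_neg (by omega), if_neg (by omega)]
  · intro r hr
    rw [PMF.uniformOfFinset_apply_of_notMem _ hr, zero_mul]

theorem map_apply_of_injective {α β : Type*} (μ : PMF α) {f : α → β}
    (hf : Function.Injective f) (a : α) : μ.map f (f a) = μ a := by
  classical
  rw [PMF.map_apply, tsum_eq_single a]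
  · simp
  · intro b hb
    rw [if_neg fun h => hb (hf h).symm]

theorem map_apply_of_notMem_range {α β : Type*} (μ : PMF α) {f : α → β} {b : β}
    (h : ∀ a, f a ≠ b) : μ.map f b = 0 := by
  classical
  rw [PMF.map_apply, ENNReal.tsum_eq_zero]
  intro a
  rw [if_neg fun h' => h a h'.symm]

theorem map_concat_apply (μ : PMF (List Move)) (m m' : Move) (s : List Move) :
    μ.map (fun t => t ++ [m]) (s ++ [m']) = if m = m' then μ s else 0 := by
  split_ifs with h
  · subst h
    exact map_apply_of_injective μ (f := fun t => t ++ [m]) (List.append_left_injective [m]) s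
  · refine map_apply_of_notMem_range _ fun t ht => h ?_
    simpa using (List.append_inj' ht rfl).2

/-- Covers states of total zero, where the chain has an arbitrary law but is entered with
probability zero. -/
theorem natCast_mul_eq_of_eq_div {x v : ℕ} (h : v ≤ x) (p : ℝ≥0∞)
    (hp : 0 < x → p = v / x) : (x : ℝ≥0∞) * p = v := by
  rcases Nat.eq_zero_or_pos x with rfl | hx
  · obtain rfl : v = 0 := by omega
    simp
  · rw [hp hx, ENNReal.mul_div_cancel (by exact_mod_cast hx.ne') (ENNReal.natCast_ne_top x)]

/-! ### Drawing a prefix from its last move to its first -/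

/-- The weight of the prefixes of length `k + 1` whose last move is horizontal. -/
def flatTotal (flatW peakW : ℕ → ℕ) (k a l : ℕ) : ℕ :=
  if l ≤ a then flatW l * prefixTotal flatW peakW k (a - l) l else 0

/-- The weight of the prefixes of length `k + 1` whose last move goes up. -/
def peakTotal (flatW peakW : ℕ → ℕ) (k a l : ℕ) : ℕ :=
  if 1 ≤ l ∧ 2 * l - 1 ≤ a then
    peakW l * prefixTotal flatW peakW k (a - (2 * l - 1)) (l - 1) else 0

theorem prefixTotal_succ (flatW peakW : ℕ → ℕ) (k a l : ℕ) :
    prefixTotal flatW peakW (k + 1) a l = prefixTotal flatW peakW k a (l + 1) +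
      flatTotal flatW peakW k a l + peakTotal flatW peakW k a l := rfl

/-- The random prefix of length `k`, completed area `a` and final height `l` whose moves are drawn
one by one, starting with the last one. -/
noncomputable def backwardChain (flatW peakW : ℕ → ℕ) : ℕ → ℕ → ℕ → PMF (List Move)
  | 0, _, _ => PMF.pure []
  | k + 1, a, l =>
      (uniformBelow (prefixTotal flatW peakW (k + 1) a l)).bind fun r =>
        if r < prefixTotal flatW peakW k a (l + 1) then
          (backwardChain flatW peakW k a (l + 1)).map fun t => t ++ [.D]
        else if r < prefixTotal flatW peakW k a (l + 1) + flatTotal flatW peakW k a l then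
          (backwardChain flatW peakW k (a - l) l).map fun t => t ++ [.H]
        else
          (backwardChain flatW peakW k (a - (2 * l - 1)) (l - 1)).map fun t => t ++ [.U]

/-- The probability of a last move has the total of the next state as a factor, which cancels the
denominator supplied by the induction hypothesis. -/
theorem WeightSystem.backwardChain_apply {flatW peakW : ℕ → ℕ} {F : Move → ℕ → ℕ} {fallW : ℕ → ℕ}
    (hF : WeightSystem flatW peakW F fallW) (k a l : ℕ) (s : List Move) (hs : s.length = k)
    (hpos : 0 < prefixTotal flatW peakW k a l) :
    backwardChain flatW peakW k a l s =
      (completionWeight F fallW s a l : ℝ≥0∞) / (prefixTotal flatW peakW k a l : ℝ≥0∞) := by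
  induction k generalizing a l s with
  | zero =>
    obtain rfl := List.length_eq_zero_iff.1 hs
    rw [prefixTotal] at hpos ⊢
    rw [hF.completionWeight_nil, backwardChain]
    split_ifs at hpos ⊢
    · simp
    · exact absurd hpos (lt_irrefl _)
  | succ k ih =>
    rcases s.eq_nil_or_concat' with rfl | ⟨s, m, rfl⟩
    · simp at hs
    have hs' : s.length = k := by simpa using hs
    have hle : ∀ a l, completionWeight F fallW s a l ≤ prefixTotal flatW peakW k a l := by
      intro a l
      rw [← hs']
      exact hF.completionWeight_le s a l
    have cancel : ∀ a l, (prefixTotal flatW peakW k a l : ℝ≥0∞) *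
        backwardChain flatW peakW k a l s = completionWeight F fallW s a l := fun a l =>
      natCast_mul_eq_of_eq_div (hle a l) _ fun h => ih a l s hs' h
    rw [prefixTotal_succ] at hpos
    rw [backwardChain, prefixTotal_succ, uniformBelow_bind_apply hpos, map_concat_apply,
      map_concat_apply, map_concat_apply]
    congr 1
    cases m with
    | D =>
      rw [hF.completionWeight_concat_D, if_pos rfl, if_neg (by decide), if_neg (by decide), cancel]
      simp
    | H =>
      rw [hF.completionWeight_concat_H, if_neg (by decide), if_pos rfl, if_neg (by decide),
        flatTotal]
      split_ifs
      · push_cast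
        rw [mul_assoc, cancel]
        simp
      · simp
    | U =>
      rw [hF.completionWeight_concat_U, if_neg (by decide), if_neg (by decide), if_pos rfl,
        peakTotal]
      split_ifs
      · push_cast
        rw [mul_assoc, cancel]
        simp
      · simp

/-! ### The program -/

/-- The sampler for the flat factor `flatW l = b * l + 1`. The loop starts at line `8`; there,
registers `0, 1, 4` hold the completed width, the completed area and the final height of the prefix
that is still to be drawn, and register `9` holds the address behind its last move. -/
def sampler (b : ℕ) : Program :=
  [ .const 4 0, .const 5 1, .add 6 2 5, .add 7 3 5, .mul 8 6 7, .mul 8 8 6, .add 9 8 8,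
    .add 9 9 0,
    -- line 8
    .jlt 4 0 10, .jmp 63,
    -- line 10
    .sub 9 9 5, .mul 10 0 7, .add 10 10 1, .mul 10 10 6, .add 11 10 4, .load 12 11,
    .add 11 11 8, .load 13 11, .add 11 10 2, .add 11 11 8, .load 14 11, .sub 13 14 13,
    .add 12 12 13, .rand 14 12, .jlt 14 13 59,
    -- line 25
    .sub 10 0 5, .sub 11 1 4, .mul 10 10 7, .add 10 10 11, .mul 10 10 6, .add 11 10 4,
    .load 12 11, .add 11 11 8, .load 15 11, .add 11 10 2, .add 11 11 8, .load 16 11,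
    .sub 15 16 15, .add 12 12 15, .const 16 b, .mul 16 16 4, .add 16 16 5, .mul 12 12 16,
    .add 12 12 13, .jlt 14 12 54,
    -- line 45
    .const 10 0, .store 9 10, .add 1 1 5, .sub 1 1 4, .sub 1 1 4, .sub 0 0 5, .sub 0 0 5,
    .sub 4 4 5, .jmp 8,
    -- line 54
    .const 10 1, .store 9 10, .sub 1 1 4, .sub 0 0 5, .jmp 8,
    -- line 59
    .const 10 2, .store 9 10, .add 4 4 5, .jmp 8 ]

/-- The next configuration, for instructions that draw no random number. -/
def Config.next (c : Config) : Instr → Option Config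
  | .const d k => some (c.setReg d k)
  | .add d a b => some (c.setReg d (c.reg a + c.reg b))
  | .sub d a b => some (c.setReg d (c.reg a - c.reg b))
  | .mul d a b => some (c.setReg d (c.reg a * c.reg b))
  | .load d a => some (c.setReg d (c.mem (c.reg a)))
  | .store a b => some { c with pc := c.pc + 1, mem := Function.update c.mem (c.reg a) (c.reg b) }
  | .rand _ _ => none
  | .jlt a b t => some { c with pc := if c.reg a < c.reg b then t else c.pc + 1 }
  | .jmp t => some { c with pc := t }

theorem exec_of_next {c c' : Config} {i : Instr} (h : c.next i = some c') :
    exec c i = PMF.pure c' := by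
  cases i <;> simp only [Config.next, Option.some.injEq, reduceCtorEq] at h <;> rw [← h] <;> rfl

/-- `m` steps that draw no random number. -/
def advance (P : Program) : ℕ → Config → Option Config
  | 0, c => some c
  | m + 1, c => (P[c.pc]?.bind c.next).bind (advance P m)

theorem run_add_of_advance {P : Program} {m : ℕ} {c c' : Config} (h : advance P m c = some c')
    (t : ℕ) : run P (m + t) c = run P t c' := by
  induction m generalizing c with
  | zero =>
    obtain rfl : c = c' := by simpa [advance] using h
    rw [Nat.zero_add]
  | succ m ih =>
    rw [advance, Option.bind_eq_some_iff] at h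
    obtain ⟨d, hd, hdc⟩ := h
    rw [Option.bind_eq_some_iff] at hd
    obtain ⟨i, hi, hid⟩ := hd
    rw [Nat.succ_add, run, step, hi]
    simp only
    rw [exec_of_next hid, PMF.pure_bind, ih hdc]

theorem advance_add {P : Program} {m m' : ℕ} {c c' c'' : Config} (h : advance P m c = some c')
    (h' : advance P m' c' = some c'') : advance P (m + m') c = some c'' := by
  induction m generalizing c with
  | zero =>
    obtain rfl : c = c' := by simpa [advance] using h
    rwa [Nat.zero_add]
  | succ m ih =>
    rw [advance, Option.bind_eq_some_iff] at h
    obtain ⟨d, hd, hdc⟩ := h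
    rw [Nat.succ_add, advance, hd]
    exact ih hdc

/-- The registers after straight-line code that neither draws nor stores nor jumps. -/
def evalRegs (mem : ℕ → ℕ) : List Instr → (ℕ → ℕ) → Option (ℕ → ℕ)
  | [], reg => some reg
  | .const d k :: is, reg => evalRegs mem is (Function.update reg d k)
  | .add d a b :: is, reg => evalRegs mem is (Function.update reg d (reg a + reg b))
  | .sub d a b :: is, reg => evalRegs mem is (Function.update reg d (reg a - reg b))
  | .mul d a b :: is, reg => evalRegs mem is (Function.update reg d (reg a * reg b))
  | .load d a :: is, reg => evalRegs mem is (Function.update reg d (mem (reg a)))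
  | _, _ => none

/-- Straight-line segments of a concrete program can thereby be executed by `rfl`. -/
theorem advance_of_evalRegs {P : Program} {mem : ℕ → ℕ} {seg : List Instr} {reg reg' : ℕ → ℕ}
    {pc : ℕ} (hP : seg <+: P.drop pc) (h : evalRegs mem seg reg = some reg') :
    advance P seg.length ⟨pc, reg, mem⟩ = some ⟨pc + seg.length, reg', mem⟩ := by
  induction seg generalizing pc reg with
  | nil =>
    obtain rfl : reg = reg' := by simpa [evalRegs] using h
    rfl
  | cons i is ih =>
    obtain ⟨rest, hrest⟩ := hP
    have hi : P[pc]? = some i := by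
      have := congrArg (fun L => L[0]?) hrest
      simpa [List.getElem?_drop] using this.symm
    have hP' : is <+: P.drop (pc + 1) := by
      refine ⟨rest, ?_⟩
      rw [← List.drop_drop, ← hrest]
      rfl
    have e : pc + (is.length + 1) = pc + 1 + is.length := by omega
    rw [List.length_cons, advance, hi, e]
    cases i with
    | const | add | sub | mul | load => exact ih hP' h
    | store | rand | jlt | jmp => simp [evalRegs] at h

theorem run_of_halted {P : Program} {c : Config} (h : Halted P c) (t : ℕ) :
    run P t c = PMF.pure c := by
  induction t with
  | zero => rfl
  | succ t ih =>
    rw [run, step, List.getElem?_eq_none h]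
    simp only
    rw [PMF.pure_bind, ih]

theorem advance_setup (b : ℕ) (reg mem : ℕ → ℕ) :
    ∃ reg', advance (sampler b) 8 ⟨0, reg, mem⟩ = some ⟨8, reg', mem⟩ ∧
      reg' 0 = reg 0 ∧ reg' 1 = reg 1 ∧ reg' 2 = reg 2 ∧ reg' 4 = 0 ∧ reg' 5 = 1 ∧
      reg' 6 = reg 2 + 1 ∧ reg' 7 = reg 3 + 1 ∧
      reg' 8 = (reg 2 + 1) * (reg 3 + 1) * (reg 2 + 1) ∧
      reg' 9 = 2 * ((reg 2 + 1) * (reg 3 + 1) * (reg 2 + 1)) + reg 0 := by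
  refine ⟨_, advance_of_evalRegs (seg := ((sampler b).drop 0).take 8)
    (List.take_prefix _ _) rfl, ?_⟩
  simp
  ring

theorem advance_to_rand (b : ℕ) (reg mem : ℕ → ℕ) (h : reg 4 < reg 0) (h5 : reg 5 = 1) :
    ∃ reg', advance (sampler b) 14 ⟨8, reg, mem⟩ = some ⟨23, reg', mem⟩ ∧
      (∀ i < 9, reg' i = reg i) ∧ reg' 9 = reg 9 - 1 ∧
      reg' 13 = mem ((reg 0 * reg 7 + reg 1) * reg 6 + reg 2 + reg 8) -
        mem ((reg 0 * reg 7 + reg 1) * reg 6 + reg 4 + reg 8) ∧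
      reg' 12 = mem ((reg 0 * reg 7 + reg 1) * reg 6 + reg 4) + reg' 13 := by
  have h0 : advance (sampler b) 1 ⟨8, reg, mem⟩ = some ⟨10, reg, mem⟩ := by
    simp [advance, sampler, Config.next, h]
  refine ⟨_, advance_add h0 (advance_of_evalRegs (seg := ((sampler b).drop 10).take 13)
    (List.take_prefix _ _) rfl), fun i hi => ?_, ?_⟩
  · interval_cases i <;> simp
  · simp [h5]

theorem run_rand (b : ℕ) (t : ℕ) (reg mem : ℕ → ℕ) :
    run (sampler b) (t + 1) ⟨23, reg, mem⟩ = (uniformBelow (reg 12)).bind fun r =>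
      run (sampler b) t ⟨24, Function.update reg 14 r, mem⟩ := by
  have h : step (sampler b) ⟨23, reg, mem⟩ =
      (uniformBelow (reg 12)).map fun r => ⟨24, Function.update reg 14 r, mem⟩ := rfl
  rw [run, h, PMF.bind_map]
  rfl

theorem advance_D (b : ℕ) (reg mem : ℕ → ℕ) (h : reg 14 < reg 13) (h5 : reg 5 = 1) :
    ∃ reg', advance (sampler b) 5 ⟨24, reg, mem⟩ =
        some ⟨8, reg', Function.update mem (reg 9) 2⟩ ∧
      (∀ i < 10, i ≠ 4 → reg' i = reg i) ∧ reg' 4 = reg 4 + 1 := by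
  have : ∀ c, advance (sampler b) 5 ⟨24, reg, mem⟩ = c ↔
      advance (sampler b) 4 ⟨59, reg, mem⟩ = c := by
    intro c
    rw [advance]
    simp [sampler, Config.next, h]
  simp only [this]
  refine ⟨_, rfl, ?_⟩
  refine ⟨fun i hi hi' => ?_, ?_⟩
  · interval_cases i <;> first | rfl | exact absurd rfl hi'
  · simp [Config.setReg, h5]

theorem advance_to_flat (b : ℕ) (reg mem : ℕ → ℕ) (h : ¬reg 14 < reg 13) (h5 : reg 5 = 1) :
    ∃ reg', advance (sampler b) 20 ⟨24, reg, mem⟩ = some ⟨44, reg', mem⟩ ∧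
      (∀ i < 10, reg' i = reg i) ∧ reg' 14 = reg 14 ∧
      reg' 12 = (mem (((reg 0 - 1) * reg 7 + (reg 1 - reg 4)) * reg 6 + reg 4) +
        (mem (((reg 0 - 1) * reg 7 + (reg 1 - reg 4)) * reg 6 + reg 2 + reg 8) -
          mem (((reg 0 - 1) * reg 7 + (reg 1 - reg 4)) * reg 6 + reg 4 + reg 8))) *
        (b * reg 4 + 1) + reg 13 := by
  have h0 : advance (sampler b) 1 ⟨24, reg, mem⟩ = some ⟨25, reg, mem⟩ := by
    simp [advance, sampler, Config.next, h]
  refine ⟨_, advance_add h0 (advance_of_evalRegs (seg := ((sampler b).drop 25).take 19)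
    (List.take_prefix _ _) rfl), fun i hi => ?_, ?_⟩
  · interval_cases i <;> simp
  · simp [h5]

theorem advance_H (b : ℕ) (reg mem : ℕ → ℕ) (h : reg 14 < reg 12) (h5 : reg 5 = 1) :
    ∃ reg', advance (sampler b) 6 ⟨44, reg, mem⟩ =
        some ⟨8, reg', Function.update mem (reg 9) 1⟩ ∧
      (∀ i < 10, i ≠ 0 → i ≠ 1 → reg' i = reg i) ∧ reg' 0 = reg 0 - 1 ∧
      reg' 1 = reg 1 - reg 4 := by
  have : ∀ c, advance (sampler b) 6 ⟨44, reg, mem⟩ = c ↔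
      advance (sampler b) 5 ⟨54, reg, mem⟩ = c := by
    intro c
    rw [advance]
    simp [sampler, Config.next, h]
  simp only [this]
  refine ⟨_, rfl, ?_⟩
  refine ⟨fun i hi h0 h1 => ?_, ?_⟩
  · interval_cases i <;> first | rfl | exact absurd rfl h0 | exact absurd rfl h1
  · simp [Config.setReg, h5]

/-- The area is increased by 1 before the two subtractions. In the opposite order truncation would
spoil the case `a = 2 * l - 1`. -/
theorem advance_U (b : ℕ) (reg mem : ℕ → ℕ) (h : ¬reg 14 < reg 12) (h5 : reg 5 = 1) :
    ∃ reg', advance (sampler b) 10 ⟨44, reg, mem⟩ =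
        some ⟨8, reg', Function.update mem (reg 9) 0⟩ ∧
      (∀ i < 10, i ≠ 0 → i ≠ 1 → i ≠ 4 → reg' i = reg i) ∧ reg' 0 = reg 0 - 1 - 1 ∧
      reg' 1 = reg 1 + 1 - reg 4 - reg 4 ∧ reg' 4 = reg 4 - 1 := by
  have : ∀ c, advance (sampler b) 10 ⟨44, reg, mem⟩ = c ↔
      advance (sampler b) 9 ⟨45, reg, mem⟩ = c := by
    intro c
    rw [advance]
    simp [sampler, Config.next, h]
  simp only [this]
  refine ⟨_, rfl, ?_⟩
  refine ⟨fun i hi h0 h1 h4 => ?_, ?_⟩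
  · interval_cases i <;>
      first | rfl | exact absurd rfl h0 | exact absurd rfl h1 | exact absurd rfl h4
  · simp [Config.setReg, h5]

theorem advance_exit (b : ℕ) (reg mem : ℕ → ℕ) (h : ¬reg 4 < reg 0) :
    advance (sampler b) 2 ⟨8, reg, mem⟩ = some ⟨63, reg, mem⟩ := by
  simp [advance, sampler, Config.next, h]

/-! ### Reading the filled table -/

theorem entryIndex_lt {N B m a l : ℕ} (hm : m ≤ N) (ha : a ≤ B) (hl : l ≤ N) :
    entryIndex N B m a l < tableSize N B := by
  have h1 : m * (B + 1) + a + 1 ≤ (N + 1) * (B + 1) := by nlinarith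
  unfold entryIndex tableSize
  nlinarith

theorem TableFilled.update {T : ℕ → ℕ → ℕ → ℕ} {N B : ℕ} {mem : ℕ → ℕ}
    (h : TableFilled T N B mem) (i v : ℕ) :
    TableFilled T N B (Function.update mem (2 * tableSize N B + i) v) := by
  intro m hm a ha l hl
  have := entryIndex_lt hm ha hl
  rw [Function.update_of_ne (by omega), Function.update_of_ne (by omega)]
  exact h m hm a ha l hl

theorem TableFilled.tail_succ {flatW peakW : ℕ → ℕ} {N B : ℕ} {mem : ℕ → ℕ}
    (h : TableFilled (dpTable flatW peakW) N B mem) {k a l : ℕ} (hk : k + 1 + l ≤ N) (ha : a ≤ B) :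
    mem (((k + 1 + l) * (B + 1) + a) * (N + 1) + N + tableSize N B) -
      mem (((k + 1 + l) * (B + 1) + a) * (N + 1) + l + tableSize N B) =
        prefixTotal flatW peakW k a (l + 1) := by
  have h1 := (h (k + 1 + l) hk a ha N le_rfl).2
  have h2 := (h (k + 1 + l) hk a ha l (by omega)).2
  rw [add_comm, entryIndex] at h1 h2
  rw [h1, h2, ← sum_Icc_dpTable _ _ k a (l + 1) N (by omega),
    ← Finset.sum_range_add_sum_Ico _ (show l + 1 ≤ N + 1 by omega), Nat.add_sub_cancel_left,
    show k + (l + 1) = k + 1 + l by omega]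
  rfl

/-- The partial sum at column `N` is the sum of the whole row. Adding the entry at `l` avoids the
partial sum at `l - 1`, so `l = 0` is no exception. -/
theorem TableFilled.tail {flatW peakW : ℕ → ℕ} {N B : ℕ} {mem : ℕ → ℕ}
    (h : TableFilled (dpTable flatW peakW) N B mem) {k a l : ℕ} (hk : k + l ≤ N) (ha : a ≤ B) :
    mem (((k + l) * (B + 1) + a) * (N + 1) + l) +
      (mem (((k + l) * (B + 1) + a) * (N + 1) + N + tableSize N B) -
        mem (((k + l) * (B + 1) + a) * (N + 1) + l + tableSize N B)) =
          prefixTotal flatW peakW k a l := by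
  have h0 := (h (k + l) hk a ha l (by omega)).1
  have h1 := (h (k + l) hk a ha N le_rfl).2
  have h2 := (h (k + l) hk a ha l (by omega)).2
  rw [entryIndex] at h0
  rw [add_comm, entryIndex] at h1 h2
  rw [h0, h1, h2, ← sum_Icc_dpTable _ _ k a l N (by omega),
    ← Finset.sum_range_add_sum_Ico _ (show l + 1 ≤ N + 1 by omega), Nat.add_sub_cancel_left,
    ← Finset.add_sum_Ioc_eq_sum_Icc (by omega)]
  exact congrArg _ (Finset.sum_congr (by ext; simp) fun _ _ => rfl)

/-! ### The loop realizes the backward chain -/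

/-- The state at the head of the loop when a prefix of length `k`, completed area `a` and final
height `l` remains to be drawn. -/
structure AtLoopHead (T : ℕ → ℕ → ℕ → ℕ) (N B k a l : ℕ) (c : Config) : Prop where
  pc : c.pc = 8
  width : c.reg 0 = k + l
  area : c.reg 1 = a
  maxWidth : c.reg 2 = N
  height : c.reg 4 = l
  one : c.reg 5 = 1
  rowLength : c.reg 6 = N + 1
  rowCount : c.reg 7 = B + 1
  size : c.reg 8 = tableSize N B
  pointer : c.reg 9 = 2 * tableSize N B + k
  table : TableFilled T N B c.mem

/-- Whether the machine has halted, together with its output. -/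
def observe (P : Program) (N B n : ℕ) (c : Config) : Prop × List ℕ :=
  (Halted P c, outputCells N B n c)

/-- The contents of the output cells from number `k` on. -/
def outputFrom (N B n k : ℕ) (mem : ℕ → ℕ) : List ℕ :=
  (List.range' k (n - k)).map fun i => mem (2 * tableSize N B + i)

theorem outputFrom_update (N B : ℕ) {n k : ℕ} (h : k < n) (mem : ℕ → ℕ) (v : ℕ) :
    outputFrom N B n k (Function.update mem (2 * tableSize N B + k) v) =
      v :: outputFrom N B n (k + 1) mem := by
  rw [outputFrom, outputFrom, show n - k = (n - (k + 1)) + 1 by omega, List.range'_succ,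
    List.map_cons, Function.update_self]
  congr 1
  refine List.map_congr_left fun i hi => ?_
  rw [List.mem_range'_1] at hi
  rw [Function.update_of_ne (by omega)]

theorem map_map_concat (μ : PMF (List Move)) (m : Move) (N B : ℕ) {n k : ℕ} (h : k < n)
    (mem : ℕ → ℕ) :
    μ.map (fun s => (True, s.map Move.code ++
        outputFrom N B n k (Function.update mem (2 * tableSize N B + k) m.code))) =
      (μ.map fun t => t ++ [m]).map
        (fun s => (True, s.map Move.code ++ outputFrom N B n (k + 1) mem)) := by
  rw [PMF.map_comp]
  congr 1
  funext s
  simp [outputFrom_update N B h]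

/-- Induction on the number of moves to draw: one pass of the loop is one step of the chain, and it
writes output cell `k - 1`, outside the tables. Observing halting and output together yields the
time bound and the law from one identity. -/
theorem map_observe_run (b : ℕ) (peakW : ℕ → ℕ) {N B n : ℕ} (k a l t : ℕ) (c : Config)
    (hc : AtLoopHead (dpTable (fun l => b * l + 1) peakW) N B k a l c) (hN : k + l ≤ N)
    (hB : a ≤ B) (hn : k ≤ n) (ht : 45 * k + 2 ≤ t)
    (hpos : 0 < prefixTotal (fun l => b * l + 1) peakW k a l) :
    (run (sampler b) t c).map (observe (sampler b) N B n) =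
      (backwardChain (fun l => b * l + 1) peakW k a l).map
        fun s => (True, s.map Move.code ++ outputFrom N B n k c.mem) := by
  induction k generalizing a l t c with
  | zero =>
    obtain ⟨pc, reg, mem⟩ := c
    obtain rfl : pc = 8 := hc.pc
    have h0 := hc.width
    have h4 := hc.height
    simp only at h0 h4
    obtain ⟨t, rfl⟩ : ∃ t', t = 2 + t' := ⟨t - 2, by omega⟩
    have hh : Halted (sampler b) ⟨63, reg, mem⟩ := le_rfl
    rw [run_add_of_advance (advance_exit b reg mem (by omega)), run_of_halted hh, PMF.pure_map,
      backwardChain, PMF.pure_map]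
    simp [observe, hh, outputCells, outputFrom, List.range_eq_range']
  | succ k ih =>
    obtain ⟨pc, reg, mem⟩ := c
    obtain ⟨rfl, h0, h1, h2, h4, h5, h6, h7, h8, h9, hT⟩ := hc
    simp only at h0 h1 h2 h4 h5 h6 h7 h8 h9 hT ⊢
    obtain ⟨t, rfl⟩ : ∃ t', t = 14 + (t' + 1) := ⟨t - 15, by omega⟩
    obtain ⟨reg', hadv, hlow, hr9, hr13, hr12⟩ := advance_to_rand b reg mem (by omega) h5
    rw [h0, h1, h2, h4, h6, h7, h8, hT.tail_succ hN hB] at hr13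
    have e12 : reg' 12 = prefixTotal (fun l => b * l + 1) peakW (k + 1) a l := by
      rw [hr12, hr13, ← hT.tail hN hB, ← hT.tail_succ hN hB, h0, h1, h4, h6, h7]
    rw [h9] at hr9
    rw [run_add_of_advance hadv, run_rand, e12, PMF.map_bind, backwardChain, PMF.map_bind]
    refine uniformBelow_bind_congr hpos fun r hr => ?_
    rw [prefixTotal_succ] at hr
    have k0 := (hlow 0 (by norm_num)).trans h0
    have k1 := (hlow 1 (by norm_num)).trans h1
    have k2 := (hlow 2 (by norm_num)).trans h2
    have k4 := (hlow 4 (by norm_num)).trans h4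
    have k5 := (hlow 5 (by norm_num)).trans h5
    have k6 := (hlow 6 (by norm_num)).trans h6
    have k7 := (hlow 7 (by norm_num)).trans h7
    have k8 := (hlow 8 (by norm_num)).trans h8
    have k9 : reg' 9 = 2 * tableSize N B + k := by rw [hr9]; omega
    clear hlow hr9 hr12 hadv h0 h1 h2 h4 h5 h6 h7 h8 h9 e12
    obtain ⟨reg2, hreg2⟩ : ∃ reg2, reg2 = Function.update reg' 14 r := ⟨_, rfl⟩
    have same : ∀ i, i ≠ 14 → reg2 i = reg' i := fun i hi => by
      rw [hreg2, Function.update_of_ne hi]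
    have r14 : reg2 14 = r := by rw [hreg2, Function.update_self]
    rw [← hreg2]
    rw [← same _ (by norm_num)] at k0 k1 k2 k4 k5 k6 k7 k8 k9 hr13
    clear same hreg2 reg'
    split_ifs with hD hH
    · obtain ⟨reg3, hadv, hlow, hr4⟩ := advance_D b reg2 mem (by rwa [r14, hr13]) k5
      obtain ⟨t, rfl⟩ : ∃ t', t = 5 + t' := ⟨t - 5, by omega⟩
      rw [run_add_of_advance hadv, k9, ih a (l + 1) t _ _ (by omega) hB (by omega) (by omega)
        (by omega)]
      · exact map_map_concat _ .D N B hn mem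
      · exact ⟨rfl, by simp [hlow, k0]; ring, by simp [hlow, k1], by simp [hlow, k2],
          by simp [hr4, k4], by simp [hlow, k5], by simp [hlow, k6], by simp [hlow, k7],
          by simp [hlow, k8], by simp [hlow, k9], hT.update k 2⟩
    · obtain ⟨reg3, hadv, hlow, hr14, hr12⟩ :=
        advance_to_flat b reg2 mem (by rwa [r14, hr13]) k5
      -- If `a < l`, the `H` interval is empty and this branch is unreachable. Hence the truncated
      -- difference `a - l` in the address is a true one.
      have hla : l ≤ a := by
        by_contra hla
        rw [flatTotal, if_neg hla] at hH
        omega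
      have hfl : 0 < prefixTotal (fun l => b * l + 1) peakW k (a - l) l := by
        rw [flatTotal, if_pos hla] at hH
        exact Nat.pos_of_mul_pos_left (a := b * l + 1) (by omega)
      rw [k0, k1, k2, k4, k6, k7, k8, show k + 1 + l - 1 = k + l by omega,
        hT.tail (by omega) (by omega), hr13] at hr12
      rw [flatTotal, if_pos hla] at hH
      have hlt : reg3 14 < reg3 12 := by rw [hr12, hr14, r14]; linarith
      obtain ⟨reg4, hadv', hlow', hs0, hs1⟩ :=
        advance_H b reg3 mem hlt ((hlow 5 (by norm_num)).trans k5)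
      have e9 : reg3 9 = 2 * tableSize N B + k := (hlow 9 (by norm_num)).trans k9
      obtain ⟨t, rfl⟩ : ∃ t', t = 20 + (6 + t') := ⟨t - 26, by omega⟩
      rw [run_add_of_advance hadv, run_add_of_advance hadv', e9,
        ih (a - l) l t _ _ (by omega) (by omega) (by omega) (by omega) hfl]
      · exact map_map_concat _ .H N B hn mem
      · exact ⟨rfl, by simp [hs0, hlow, k0, Nat.succ_add], by simp [hs1, hlow, k1, k4],
          by simp [hlow', hlow, k2], by simp [hlow', hlow, k4], by simp [hlow', hlow, k5],
          by simp [hlow', hlow, k6], by simp [hlow', hlow, k7], by simp [hlow', hlow, k8],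
          by simp [hlow', e9], hT.update k 1⟩
    · obtain ⟨reg3, hadv, hlow, hr14, hr12⟩ :=
        advance_to_flat b reg2 mem (by rwa [r14, hr13]) k5
      have hpeak : 0 < peakTotal (fun l => b * l + 1) peakW k a l := by omega
      obtain ⟨hl, hla⟩ : 1 ≤ l ∧ 2 * l - 1 ≤ a := by
        by_contra hla
        rw [peakTotal, if_neg hla] at hpeak
        omega
      rw [peakTotal, if_pos ⟨hl, hla⟩] at hpeak
      have hpk := Nat.pos_of_mul_pos_left hpeak
      rw [k0, k1, k2, k4, k6, k7, k8, show k + 1 + l - 1 = k + l by omega,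
        hT.tail (by omega) (by omega), hr13] at hr12
      -- Here `l ≤ 2 * l - 1 ≤ a` because `1 ≤ l`, so the flat row read by the program is the right
      -- one.
      rw [flatTotal, if_pos (by omega)] at hH
      have hge : ¬reg3 14 < reg3 12 := by rw [hr12, hr14, r14]; linarith
      obtain ⟨reg4, hadv', hlow', hs0, hs1, hs4⟩ :=
        advance_U b reg3 mem hge ((hlow 5 (by norm_num)).trans k5)
      have e9 : reg3 9 = 2 * tableSize N B + k := (hlow 9 (by norm_num)).trans k9
      obtain ⟨t, rfl⟩ : ∃ t', t = 20 + (10 + t') := ⟨t - 30, by omega⟩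
      rw [run_add_of_advance hadv, run_add_of_advance hadv', e9,
        ih (a - (2 * l - 1)) (l - 1) t _ _ (by omega) (by omega) (by omega) (by omega) hpk]
      · exact map_map_concat _ .U N B hn mem
      · exact ⟨rfl, by simp [hs0, hlow, k0]; omega, by simp [hs1, hlow, k1, k4]; omega,
          by simp [hlow', hlow, k2], by simp [hs4, hlow, k4], by simp [hlow', hlow, k5],
          by simp [hlow', hlow, k6], by simp [hlow', hlow, k7], by simp [hlow', hlow, k8],
          by simp [hlow', e9], hT.update k 0⟩

theorem Move.code_injective : Function.Injective Move.code := by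
  intro x y h
  cases x <;> cases y <;> first | rfl | exact absurd h (by decide)

theorem isLinearTimeSampler_sampler {b : ℕ} {peakW : ℕ → ℕ} {F : Move → ℕ → ℕ} {fallW : ℕ → ℕ}
    (hF : WeightSystem (fun l => b * l + 1) peakW F fallW) :
    IsLinearTimeSampler (dpTable (fun l => b * l + 1) peakW) (pathWeight F) (sampler b) := by
  -- The longest pass of the loop is the one that draws `U`: 14 + 1 + 20 + 10 = 45 steps. The extra
  -- 45 steps cover the 8 of the setup and the 2 of the exit.
  refine ⟨45, fun N B n A hn hA hne c hpc h0 h1 h2 h3 hT => ?_⟩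
  have hpos := hF.prefixTotal_pos hne
  have hrun : (run (sampler b) (45 * (n + 1)) c).map (observe (sampler b) N B n) =
      (backwardChain (fun l => b * l + 1) peakW n A 0).map fun s => (True, s.map Move.code) := by
    obtain ⟨pc, reg, mem⟩ := c
    simp only at hpc h0 h1 h2 h3 hT
    subst hpc
    obtain ⟨reg', hadv, e0, e1, e2, e4, e5, e6, e7, e8, e9⟩ := advance_setup b reg mem
    rw [h0] at e0 e9
    rw [h1] at e1
    rw [h2] at e2 e6 e8 e9
    rw [h3] at e7 e8 e9
    rw [show 45 * (n + 1) = 8 + (45 * n + 37) by ring, run_add_of_advance hadv,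
      map_observe_run b peakW n A 0 _ _ ⟨rfl, e0, e1, e2, e4, e5, e6, e7, e8, e9, hT⟩ hn hA le_rfl
        (by omega) hpos]
    simp [outputFrom]
  constructor
  · intro c' hc'
    have hmem : observe (sampler b) N B n c' ∈
        ((run (sampler b) (45 * (n + 1)) c).map (observe (sampler b) N B n)).support := by
      rw [PMF.support_map]
      exact ⟨c', hc', rfl⟩
    rw [hrun, PMF.support_map] at hmem
    obtain ⟨s, -, hs⟩ := hmem
    -- Every point in the support of the observed law has first component `True`.
    have hh : True = Halted (sampler b) c' := congrArg Prod.fst hs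
    exact hh ▸ trivial
  · intro p hp
    have hout : (run (sampler b) (45 * (n + 1)) c).map (outputCells N B n) =
        (backwardChain (fun l => b * l + 1) peakW n A 0).map (List.map Move.code) := by
      have := congrArg (PMF.map Prod.snd) hrun
      rw [PMF.map_comp, PMF.map_comp] at this
      exact this
    rw [hout, map_apply_of_injective _ (List.map_injective_iff.2 Move.code_injective),
      hF.backwardChain_apply n A 0 p (mem_motzkinPaths.1 hp).1 hpos,
      hF.completionWeight_of_mem hp, hF.sum_pathWeight]

end MotzkinSampling

theorem theorem5 :
    (∃ P : MotzkinSampling.Program,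
      MotzkinSampling.IsLinearTimeSampler MotzkinSampling.tableM (fun _ => 1) P) ∧
    (∃ P : MotzkinSampling.Program,
      MotzkinSampling.IsLinearTimeSampler MotzkinSampling.tableD MotzkinSampling.weight P) := by
  constructor
  · refine ⟨MotzkinSampling.sampler 0, ?_⟩
    have h := MotzkinSampling.isLinearTimeSampler_sampler (b := 0) (peakW := fun _ => 1)
      (F := fun _ _ => 1) (fallW := fun _ => 1)
      ⟨rfl, fun _ => rfl, fun _ => by simp, fun _ => rfl, fun _ _ => one_pos, one_pos⟩
    have e1 : (fun l => 0 * l + 1) = fun _ : ℕ => 1 := by funext l; simp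
    have e2 : MotzkinSampling.pathWeight (fun _ _ => 1) = fun _ => 1 := by
      funext p
      simp [MotzkinSampling.pathWeight]
    rwa [e1, e2] at h
  · refine ⟨MotzkinSampling.sampler 2, ?_⟩
    -- A fall from height `l` has the factors `l, …, 1`, hence weight `l!`. The condition for `U`
    -- becomes `(l + 1) * (l + 1)! = (l + 1) ^ 2 * l!`.
    exact MotzkinSampling.isLinearTimeSampler_sampler (b := 2) (peakW := fun l => l ^ 2)
      (F := MotzkinSampling.Move.factor) (fallW := Nat.factorial)
      ⟨rfl, fun l => rfl, fun _ => rfl,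
        fun l => by
          simp only [MotzkinSampling.Move.factor, Nat.factorial_succ]
          ring,
        fun m l => by cases m <;> simp [MotzkinSampling.Move.factor],
        by simp [MotzkinSampling.Move.factor]⟩
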